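/- Let $K\subseteq\mathbb{R}^d$ be a compact set with positive Lebesgue measure, and let $P$ be the uniform probability distribution on $K$ (normalized Lebesgue measure). Let $\mathcal{P}(K)$ be the set of Borel probability measures on $K$, with the topology of weak convergence, and for $Q\in\mathcal{P}(K)$ let $\operatorname{sprt}Q$ be its support (a closed subset of $K$). Let $k:K\times K\to\mathbb{R}$ be a continuous kernel that is integrally strictly positive definite, i.e. $k$ is symmetric and $$\int_K\int_K k(\mathbf{x},\mathbf{x}')\,dm(\mathbf{x}')\,dm(\mathbf{x})>0\quad\text{for every nonzero finite signed Borel measure } m \text{ on } K.$$ For $V\in C(K)$ let $Q_V\in\mathcal{P}(K)$ be the distribution $dQ_V=\frac1Z e^{-V}\,dP$ with $Z=\mathbb{E}_P[e^{-V}]$. Let $Q'\in\mathcal{P}(K)$ be any target distribution with $\operatorname{sprt}Q'\subseteq\operatorname{sprt}P$ (this is automatic if $P$ has full support in $K$), and let $V_0\in C(K)$ be any initialization. Let $V_t\in C(K)$, $t\ge 0$, start at $V_0$ and satisfy, with $Q_t:=Q_{V_t}$, $$\frac{d}{dt}V_t(\mathbf{x})=\int_K k(\mathbf{x},\mathbf{x}')\,d(Q_t-Q')(\mathbf{x}')\qquad\text{for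 all } t\ge0,\ \mathbf{x}\in K.$$ Call $R\in\mathcal{P}(K)$ a weak limit point of $(Q_t)$ if $R\in\bigcap_{T\ge0}\overline{\{Q_t: t\ge T\}}$ (weak closure). Then: 1. If $(Q_t)$ has exactly one weak limit point, then $Q_t$ converges weakly to $Q'$ as $t\to\infty$. 2. Otherwise, no weak limit point $R$ of $(Q_t)$ covers the support of $Q'$, i.e. $\operatorname{sprt}Q'\not\subseteq\operatorname{sprt}R$. -/

import Mathlib

open MeasureTheory Set Filter Topology
open scoped ENNReal

noncomputable section

/-- The uniform distribution on a compact set `K ⊆ ℝᵈ` of positive Lebesgue measure, as a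
probability measure on the subspace `K`: the Lebesgue measure on `K`, divided by its total mass. -/
def uniformOnCompact {d : ℕ} (K : TopologicalSpace.Compacts (EuclideanSpace ℝ (Fin d)))
    (hK : 0 < volume (K : Set (EuclideanSpace ℝ (Fin d)))) : ProbabilityMeasure K :=
  ⟨(volume (K : Set (EuclideanSpace ℝ (Fin d))))⁻¹ •
      (volume : Measure (EuclideanSpace ℝ (Fin d))).comap ((↑) : K → EuclideanSpace ℝ (Fin d)), by
    constructor
    have he : MeasurableEmbedding ((↑) : K → EuclideanSpace ℝ (Fin d)) :=
      MeasurableEmbedding.subtype_coe K.isCompact.measurableSet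
    have hr : range ((↑) : K → EuclideanSpace ℝ (Fin d)) = (K : Set _) := Subtype.range_coe
    rw [Measure.smul_apply, he.comap_apply, image_univ, hr, smul_eq_mul]
    exact ENNReal.inv_mul_cancel hK.ne' K.isCompact.measure_lt_top.ne⟩

/-- The distribution `Q = e^{-V} P / Z`, `Z = 𝔼_P[e^{-V}]`, generated by a continuous potential `V`
and a base distribution `P` on a compact space. -/
def potentialDistribution {X : Type*} [TopologicalSpace X] [CompactSpace X] [MeasurableSpace X]
    [BorelSpace X] (P : ProbabilityMeasure X) (V : C(X, ℝ)) : ProbabilityMeasure X :=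
  ⟨(P : Measure X).tilted (fun x => -V x), isProbabilityMeasure_tilted (by
    have hc : Continuous fun x => Real.exp (-V x) := by fun_prop
    exact hc.integrable_of_hasCompactSupport (HasCompactSupport.of_compactSpace _))⟩

/-- The form `𝔼_{m(x)} 𝔼_{m'(x')} [k(x, x')]` on finite signed measures, where integrals against a
signed measure are Mathlib's. -/
def kernelForm {X : Type*} [MeasurableSpace X] (k : X → X → ℝ) (m m' : SignedMeasure X) : ℝ :=
  m.integral (fun x => m'.integral (fun x' => k x x') (ContinuousLinearMap.lsmul ℝ ℝ).flip)
    (ContinuousLinearMap.lsmul ℝ ℝ).flip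

/-- Integrally strictly positive definite kernels: symmetric kernels whose quadratic form is
strictly positive at every nonzero finite signed measure. -/
def IntegrallyStrictlyPosDef {X : Type*} [MeasurableSpace X] (k : X → X → ℝ) : Prop :=
  (∀ x x', k x x' = k x' x) ∧ ∀ m : SignedMeasure X, m ≠ 0 → 0 < kernelForm k m m

/-- `V` solves `d/dt V_t(x) = 𝔼_{(Q_t - Q')(x')}[k(x, x')]` for all `t ≥ 0` and all `x`
(one-sided derivative at `t = 0`), where `Q_t` is generated by `V_t` from the base distribution
`P`. Values of `V` at negative times are irrelevant. -/
def IsPotentialFlow {X : Type*} [TopologicalSpace X] [CompactSpace X] [MeasurableSpace X]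
    [BorelSpace X] (P Q' : ProbabilityMeasure X) (k : X → X → ℝ) (V : ℝ → C(X, ℝ)) : Prop :=
  ∀ t : ℝ, 0 ≤ t → ∀ x : X,
    HasDerivWithinAt (fun s => V s x)
      ((∫ x', k x x' ∂(potentialDistribution P (V t) : Measure X)) -
        ∫ x', k x x' ∂(Q' : Measure X))
      (Ici 0) t

/-- `R` is a weak limit point, as `t → ∞`, of the curve `Q` of probability measures, i.e.
`R ∈ ⋂_T closure {Q_t : t ≥ T}` for the topology of weak convergence. -/
def IsWeakLimitPoint {X : Type*} [TopologicalSpace X] [MeasurableSpace X] [OpensMeasurableSpace X]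
    (Q : ℝ → ProbabilityMeasure X) (R : ProbabilityMeasure X) : Prop :=
  ∀ T : ℝ, R ∈ closure (Q '' Ici T)

end

/-! Let `g_Q(x) = ∫ k(x,·) d(Q - Q')`, the velocity of the potential, and let `E(Q) = ∫ g_Q d(Q -
Q')`. By strict positive definiteness `E` vanishes only at `Q'`. Along the flow `E' = -2
Var_Q(g_Q)`. Since `E` is bounded below and the variance has bounded derivative (everything is
continuous on the compact space of probability measures), the variance tends to 0. Hence at every
limit point `R` the function `g_R` is a constant `c` on the support of `R`.

If that support covers the support of `Q'`, then `E(R) = c - c = 0` and `R = Q'`. As `E` converges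
along the whole flow, its limit is then 0, so `Q'` is the only limit point; this gives the second
claim (`eq_of_support_subset`, `eq_target_of_isWeakLimitPoint`).

If the limit point `R` is unique, compactness gives `Q_t → R`, and the velocities converge uniformly
to `g_R`. Were `g_R < c` somewhere on the support of `P`, the density `e^{-V_t}` there would outgrow
exponentially the density near `{g_R = c}`, which carries all the mass of `R`. So `g_R ≥ c` on the
support of `Q'`, whence `E(R) ≤ 0` and `R = Q'` (`le_witness_of_tendsto`). -/

namespace PotentialFlow

open ProbabilityTheory

/-! ### Joint continuity of integration -/

section Integral

variable {X : Type*} [TopologicalSpace X] [CompactSpace X] [MeasurableSpace X] [BorelSpace X]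

lemma integrable_continuousMap (μ : Measure X) [IsFiniteMeasure μ] (f : C(X, ℝ)) :
    Integrable (fun x => f x) μ :=
  f.continuous.integrable_of_hasCompactSupport (HasCompactSupport.of_compactSpace _)

/-- Split the varying integrand as `f` plus an error: weak convergence handles the fixed `f`, and
the sup norm bounds the error uniformly over probability measures. -/
lemma continuous_integral_prod :
    Continuous fun p : ProbabilityMeasure X × C(X, ℝ) => ∫ x, p.2 x ∂(p.1 : Measure X) := by
  rw [continuous_iff_continuousAt]
  rintro ⟨Q, f⟩
  have h1 : Tendsto (fun p : ProbabilityMeasure X × C(X, ℝ) => ∫ x, f x ∂(p.1 : Measure X))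
      (𝓝 (Q, f)) (𝓝 (∫ x, f x ∂(Q : Measure X))) :=
    ProbabilityMeasure.tendsto_iff_forall_integral_tendsto.1
      (continuous_fst.tendsto (Q, f)) (BoundedContinuousFunction.mkOfCompact f)
  have h2 : Tendsto (fun p : ProbabilityMeasure X × C(X, ℝ) =>
      ∫ x, (p.2 - f) x ∂(p.1 : Measure X)) (𝓝 (Q, f)) (𝓝 0) := by
    have h3 : Tendsto (fun p : ProbabilityMeasure X × C(X, ℝ) => ‖p.2 - f‖) (𝓝 (Q, f)) (𝓝 0) := by
      have : Continuous fun p : ProbabilityMeasure X × C(X, ℝ) => ‖p.2 - f‖ := by fun_prop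
      simpa using this.tendsto (Q, f)
    refine squeeze_zero_norm (fun p => ?_) h3
    simpa using norm_integral_le_of_norm_le_const (μ := (p.1 : Measure X))
      (Eventually.of_forall fun x => (p.2 - f).norm_coe_le_norm x)
  have h := h1.add h2
  rw [add_zero] at h
  refine h.congr fun p => ?_
  rw [← integral_add (integrable_continuousMap _ f) (integrable_continuousMap _ (p.2 - f))]
  simp

lemma Continuous.integral_probabilityMeasure {Y : Type*} [TopologicalSpace Y]
    {Q : Y → ProbabilityMeasure X} {f : Y → C(X, ℝ)} (hQ : Continuous Q) (hf : Continuous f) :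
    Continuous fun y => ∫ x, f y x ∂(Q y : Measure X) :=
  continuous_integral_prod.comp (hQ.prodMk hf)

end Integral

/-! ### Witness function, discrepancy and variance -/

section Witness

variable {X : Type*} [MetricSpace X] [CompactSpace X] [MeasurableSpace X] [BorelSpace X]

/-- The function `x ↦ ∫ k x d(Q - Q')`, as a continuous function of `Q`. -/
noncomputable def witness (k : C(X, C(X, ℝ))) (Q' : ProbabilityMeasure X) :
    C(ProbabilityMeasure X, C(X, ℝ)) :=
  ContinuousMap.curry ⟨fun p => (∫ y, k p.2 y ∂(p.1 : Measure X)) - ∫ y, k p.2 y ∂(Q' : Measure X),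
    (Continuous.integral_probabilityMeasure continuous_fst (by fun_prop)).sub
      (Continuous.integral_probabilityMeasure continuous_const (by fun_prop))⟩

lemma witness_apply (k : C(X, C(X, ℝ))) (Q' Q : ProbabilityMeasure X) (x : X) :
    witness k Q' Q x = (∫ y, k x y ∂(Q : Measure X)) - ∫ y, k x y ∂(Q' : Measure X) := rfl

/-- The derivative of `witness k Q' (Q t)` in the direction of the flow. -/
noncomputable def witnessDeriv (k : C(X, C(X, ℝ))) (Q' : ProbabilityMeasure X) :
    C(ProbabilityMeasure X, C(X, ℝ)) :=
  ContinuousMap.curry ⟨fun p => (∫ y, k p.2 y ∂(p.1 : Measure X)) *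
      (∫ y, witness k Q' p.1 y ∂(p.1 : Measure X)) -
      ∫ y, (k p.2 * witness k Q' p.1) y ∂(p.1 : Measure X),
    ((Continuous.integral_probabilityMeasure continuous_fst (by fun_prop)).mul
      (Continuous.integral_probabilityMeasure continuous_fst (by fun_prop))).sub
      (Continuous.integral_probabilityMeasure continuous_fst (by fun_prop))⟩

lemma witnessDeriv_apply (k : C(X, C(X, ℝ))) (Q' Q : ProbabilityMeasure X) (x : X) :
    witnessDeriv k Q' Q x = (∫ y, k x y ∂(Q : Measure X)) *
      (∫ y, witness k Q' Q y ∂(Q : Measure X)) -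
      ∫ y, k x y * witness k Q' Q y ∂(Q : Measure X) := rfl

/-- The squared maximum mean discrepancy between `Q` and `Q'`. -/
noncomputable def discrepancy (k : C(X, C(X, ℝ))) (Q' Q : ProbabilityMeasure X) : ℝ :=
  (∫ x, witness k Q' Q x ∂(Q : Measure X)) - ∫ x, witness k Q' Q x ∂(Q' : Measure X)

/-- The variance of the witness function under `Q`. -/
noncomputable def dissipation (k : C(X, C(X, ℝ))) (Q' Q : ProbabilityMeasure X) : ℝ :=
  (∫ x, witness k Q' Q x * witness k Q' Q x ∂(Q : Measure X)) -
    (∫ x, witness k Q' Q x ∂(Q : Measure X)) ^ 2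

lemma continuous_discrepancy (k : C(X, C(X, ℝ))) (Q' : ProbabilityMeasure X) :
    Continuous (discrepancy k Q') :=
  (Continuous.integral_probabilityMeasure continuous_id (by fun_prop)).sub
    (Continuous.integral_probabilityMeasure continuous_const (by fun_prop))

lemma continuous_dissipation (k : C(X, C(X, ℝ))) (Q' : ProbabilityMeasure X) :
    Continuous (dissipation k Q') :=
  (Continuous.integral_probabilityMeasure (f := fun Q => witness k Q' Q * witness k Q' Q)
    continuous_id (by fun_prop)).sub
    ((Continuous.integral_probabilityMeasure continuous_id (by fun_prop)).pow 2)

lemma dissipation_eq_variance (k : C(X, C(X, ℝ))) (Q' Q : ProbabilityMeasure X) :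
    dissipation k Q' Q = Var[fun x => witness k Q' Q x; (Q : Measure X)] := by
  rw [variance_eq_sub]
  · simp [dissipation, pow_two]
  · exact (BoundedContinuousFunction.mkOfCompact (witness k Q' Q)).memLp_top.mono_exponent le_top

lemma dissipation_nonneg (k : C(X, C(X, ℝ))) (Q' Q : ProbabilityMeasure X) :
    0 ≤ dissipation k Q' Q := by
  rw [dissipation_eq_variance]
  exact variance_nonneg _ _

/-- Zero variance gives equality with the mean almost everywhere; the equality set is closed, so it
contains the support. -/
lemma witness_eq_of_mem_support {k : C(X, C(X, ℝ))} {Q' R : ProbabilityMeasure X}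
    (h : dissipation k Q' R = 0) {x : X} (hx : x ∈ (R : Measure X).support) :
    witness k Q' R x = ∫ y, witness k Q' R y ∂(R : Measure X) := by
  rw [dissipation_eq_variance] at h
  have h1 := ae_eq_integral_of_variance_eq_zero
    ((BoundedContinuousFunction.mkOfCompact (witness k Q' R)).memLp_top.mono_exponent le_top) h
  exact Measure.support_subset_of_isClosed
    (isClosed_eq (witness k Q' R).continuous continuous_const) h1 hx

lemma kernelForm_sub_eq_discrepancy (k : C(X, C(X, ℝ))) (Q' Q : ProbabilityMeasure X) :
    kernelForm (fun x y => k x y) ((Q : Measure X).toSignedMeasure - (Q' : Measure X).toSignedMeasure)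
      ((Q : Measure X).toSignedMeasure - (Q' : Measure X).toSignedMeasure) =
      discrepancy k Q' Q := by
  have hint (R : ProbabilityMeasure X) (f : C(X, ℝ)) :
      VectorMeasure.Integrable (R : Measure X).toSignedMeasure (fun x => f x) := by
    rw [VectorMeasure.Integrable, Measure.variation_toSignedMeasure]
    exact integrable_continuousMap _ f
  have h (f : C(X, ℝ)) : VectorMeasure.integral
      ((Q : Measure X).toSignedMeasure - (Q' : Measure X).toSignedMeasure) (fun x => f x)
      (ContinuousLinearMap.lsmul ℝ ℝ).flip =
      (∫ x, f x ∂(Q : Measure X)) - ∫ x, f x ∂(Q' : Measure X) := by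
    rw [VectorMeasure.integral_sub_vectorMeasure (hint _ f) (hint _ f),
      VectorMeasure.integral_toSignedMeasure, VectorMeasure.integral_toSignedMeasure]
  simp only [kernelForm, h]
  exact h (witness k Q' Q)

lemma discrepancy_pos {k : C(X, C(X, ℝ))} (hk : IntegrallyStrictlyPosDef fun x y => k x y)
    {Q' Q : ProbabilityMeasure X} (hne : Q ≠ Q') : 0 < discrepancy k Q' Q := by
  rw [← kernelForm_sub_eq_discrepancy]
  refine hk.2 _ fun h => hne ?_
  rw [sub_eq_zero, Measure.toSignedMeasure_eq_toSignedMeasure_iff] at h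
  exact Subtype.ext h

lemma eq_of_support_subset {k : C(X, C(X, ℝ))} (hk : IntegrallyStrictlyPosDef fun x y => k x y)
    {Q' R : ProbabilityMeasure X} (h : dissipation k Q' R = 0)
    (hs : (Q' : Measure X).support ⊆ (R : Measure X).support) : R = Q' := by
  by_contra hne
  refine (discrepancy_pos hk hne).ne' ?_
  have h1 : ∀ᵐ x ∂(Q' : Measure X), witness k Q' R x = ∫ y, witness k Q' R y ∂(R : Measure X) := by
    filter_upwards [Measure.support_mem_ae (μ := (Q' : Measure X))] with x hx
    exact witness_eq_of_mem_support h (hs hx)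
  rw [discrepancy, integral_congr_ae h1]
  simp

/-- By Fubini and symmetry, integrating `k x y` in `x` against `Q - Q'` reproduces the witness at
`y`, leaving `(∫ g dQ)² - ∫ g² dQ`. -/
lemma integral_witnessDeriv_sub {k : C(X, C(X, ℝ))} (hk : ∀ x y, k x y = k y x)
    (Q' Q : ProbabilityMeasure X) :
    (∫ x, witnessDeriv k Q' Q x ∂(Q : Measure X)) - ∫ x, witnessDeriv k Q' Q x ∂(Q' : Measure X) =
      -dissipation k Q' Q := by
  have hcont (f : C(X, ℝ)) (R : ProbabilityMeasure X) :
      Continuous fun x => ∫ y, k x y * f y ∂(R : Measure X) :=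
    Continuous.integral_probabilityMeasure (f := fun x => k x * f) continuous_const (by fun_prop)
  have hcont1 (R : ProbabilityMeasure X) : Continuous fun x => ∫ y, k x y ∂(R : Measure X) :=
    Continuous.integral_probabilityMeasure continuous_const (by fun_prop)
  have hi {f : X → ℝ} (hf : Continuous f) (R : ProbabilityMeasure X) :
      Integrable f (R : Measure X) := integrable_continuousMap (R : Measure X) ⟨f, hf⟩
  have hswap (R : ProbabilityMeasure X) (f : C(X, ℝ)) :
      ∫ x, ∫ y, k x y * f y ∂(Q : Measure X) ∂(R : Measure X) =
        ∫ y, f y * ∫ x, k y x ∂(R : Measure X) ∂(Q : Measure X) := by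
    rw [integral_integral_swap_of_hasCompactSupport (by fun_prop)
      (HasCompactSupport.of_compactSpace _)]
    refine integral_congr_ae (Eventually.of_forall fun y => ?_)
    simp only [hk _ y, mul_comm _ (f y)]
    exact integral_const_mul _ _
  have hswap1 (R : ProbabilityMeasure X) : ∫ x, ∫ y, k x y ∂(Q : Measure X) ∂(R : Measure X) =
        ∫ y, ∫ x, k y x ∂(R : Measure X) ∂(Q : Measure X) := by
    simpa using hswap R 1
  have hR (R : ProbabilityMeasure X) : ∫ x, witnessDeriv k Q' Q x ∂(R : Measure X) =
      (∫ y, ∫ x, k y x ∂(R : Measure X) ∂(Q : Measure X)) *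
        (∫ y, witness k Q' Q y ∂(Q : Measure X)) -
      ∫ y, witness k Q' Q y * ∫ x, k y x ∂(R : Measure X) ∂(Q : Measure X) := by
    simp only [witnessDeriv_apply]
    rw [integral_sub (hi ((hcont1 Q).fun_mul continuous_const) R) (hi (hcont _ _) R),
      integral_mul_const, hswap1, hswap]
  have h1 : ∫ y, witness k Q' Q y ∂(Q : Measure X) =
      (∫ y, ∫ x, k y x ∂(Q : Measure X) ∂(Q : Measure X)) -
        ∫ y, ∫ x, k y x ∂(Q' : Measure X) ∂(Q : Measure X) := by
    simp only [witness_apply]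
    exact integral_sub (hi (hcont1 _) Q) (hi (hcont1 _) Q)
  have h2 : ∫ y, witness k Q' Q y * witness k Q' Q y ∂(Q : Measure X) =
      (∫ y, witness k Q' Q y * ∫ x, k y x ∂(Q : Measure X) ∂(Q : Measure X)) -
        ∫ y, witness k Q' Q y * ∫ x, k y x ∂(Q' : Measure X) ∂(Q : Measure X) := by
    rw [← integral_sub (hi ((witness k Q' Q).continuous.fun_mul (hcont1 _)) Q)
      (hi ((witness k Q' Q).continuous.fun_mul (hcont1 _)) Q)]
    refine integral_congr_ae (Eventually.of_forall fun y => ?_)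
    simp only [witness_apply]
    ring
  rw [hR, hR, dissipation, h2]
  linear_combination -(∫ y, witness k Q' Q y ∂(Q : Measure X)) * h1

end Witness

/-! ### A Barbalat-type decay lemma -/

lemma tendsto_zero_of_dissipation {E v v' : ℝ → ℝ} {b C : ℝ} (hC : 0 < C)
    (hE : ∀ t, 0 < t → HasDerivAt E (-2 * v t) t) (hv : ∀ t, 0 < t → HasDerivAt v (v' t) t)
    (hv' : ∀ t, 0 < t → |v' t| ≤ C) (hv0 : ∀ t, 0 ≤ v t) (hb : ∀ t, b ≤ E t) :
    (∃ L, Tendsto E atTop (𝓝 L)) ∧ Tendsto v atTop (𝓝 0) := by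
  have hEanti : AntitoneOn E (Ioi 0) := by
    refine antitoneOn_of_deriv_nonpos (convex_Ioi 0)
      (fun t ht => (hE t ht).continuousAt.continuousWithinAt) ?_ ?_
    · rw [interior_Ioi]
      exact fun t ht => (hE t ht).differentiableAt.differentiableWithinAt
    · rw [interior_Ioi]
      intro t ht
      rw [(hE t ht).deriv]
      linarith [hv0 t]
  have hlim : ∃ L, Tendsto E atTop (𝓝 L) := by
    -- Monotonicity is known only at positive times, so `E` is frozen before time 1.
    have hanti : Antitone fun t => E (max t 1) := fun s t hst =>
      hEanti (mem_Ioi.2 (lt_max_of_lt_right one_pos)) (mem_Ioi.2 (lt_max_of_lt_right one_pos)) (max_le_max_right 1 hst)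
    refine ⟨_, (tendsto_atTop_ciInf hanti ⟨b, ?_⟩).congr' ?_⟩
    · rintro _ ⟨t, rfl⟩
      exact hb _
    · filter_upwards [eventually_ge_atTop 1] with t ht
      rw [max_eq_left ht]
  refine ⟨hlim, ?_⟩
  obtain ⟨L, hL⟩ := hlim
  have hLle : ∀ t, 0 < t → L ≤ E t := fun t ht => by
    refine le_of_tendsto hL ?_
    filter_upwards [eventually_ge_atTop t] with s hs
    exact hEanti ht (ht.trans_le hs) hs
  have hsq : ∀ t, 0 < t → v t ^ 2 ≤ C * (E t - L) := by
    intro t ht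
    have hpos : ∀ s ∈ Ici t, 0 < s := fun s hs => ht.trans_le hs
    have hlip : ∀ s ∈ Ici t, v t - C * (s - t) ≤ v s := by
      intro s hs
      have := (convex_Ici t).norm_image_sub_le_of_norm_hasDerivWithin_le
        (fun x hx => (hv x (hpos x hx)).hasDerivWithinAt) (fun x hx => hv' x (hpos x hx))
        self_mem_Ici hs
      rw [Real.norm_eq_abs, Real.norm_eq_abs, abs_of_nonneg (sub_nonneg.2 (mem_Ici.1 hs))] at this
      linarith [neg_abs_le (v s - v t)]
    -- This function integrates the linear lower bound on `v`; it is antitone exactly because of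
    -- `hlip`.
    have hder : ∀ s ∈ Ici t, HasDerivAt
        (fun s => E s + (2 * v t * (s - t) - C * (s - t) ^ 2))
        (-2 * v s + (2 * v t - C * (2 * (s - t)))) s := by
      intro s hs
      have h1 := (hasDerivAt_id s).sub_const t
      have h2 := (h1.const_mul (2 * v t)).sub ((h1.pow 2).const_mul C)
      refine ((hE s (hpos s hs)).add h2).congr_deriv ?_
      simp
    have hanti : AntitoneOn (fun s => E s + (2 * v t * (s - t) - C * (s - t) ^ 2)) (Ici t) := by
      refine antitoneOn_of_deriv_nonpos (convex_Ici t)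
        (fun s hs => (hder s hs).continuousAt.continuousWithinAt)
        (fun s hs => (hder s (interior_subset hs)).differentiableAt.differentiableWithinAt)
        (fun s hs => ?_)
      rw [(hder s (interior_subset hs)).deriv]
      linarith [hlip s (interior_subset hs)]
    -- At time `t + v t / C` the linear lower bound reaches 0; by then `E` has dropped by at least
    -- `v t ^ 2 / C`.
    have hle : t ≤ t + v t / C := le_add_of_nonneg_right (div_nonneg (hv0 t) hC.le)
    have h1 := hanti self_mem_Ici (mem_Ici.2 hle) hle
    have h2 := hLle _ (ht.trans_le hle)
    simp only [add_sub_cancel_left, sub_self] at h1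
    have h3 : 2 * v t * (v t / C) - C * (v t / C) ^ 2 = v t ^ 2 / C := by
      field_simp
      ring
    rw [h3] at h1
    have h4 : v t ^ 2 / C ≤ E t - L := by nlinarith
    rwa [div_le_iff₀' hC] at h4
  have h0 : Tendsto (fun t => v t ^ 2) atTop (𝓝 0) := by
    have h1 : Tendsto (fun t => C * (E t - L)) atTop (𝓝 0) := by
      simpa using (hL.sub_const L).const_mul C
    refine squeeze_zero' (Eventually.of_forall fun t => sq_nonneg _) ?_ h1
    filter_upwards [eventually_gt_atTop 0] with t ht using hsq t ht
  have h1 := h0.sqrt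
  simpa [Real.sqrt_sq (hv0 _)] using h1

lemma norm_sub_le_of_hasDerivAt {X : Type*} [TopologicalSpace X] [CompactSpace X]
    {F F' : ℝ → C(X, ℝ)} {C : ℝ}
    (hF : ∀ t, 0 < t → ∀ x, HasDerivAt (fun s => F s x) (F' t x) t) (hC : ∀ t, 0 < t → ‖F' t‖ ≤ C)
    {s t : ℝ} (hs : 0 < s) (ht : 0 < t) : ‖F s - F t‖ ≤ C * |s - t| := by
  have hC0 : 0 ≤ C := (norm_nonneg _).trans (hC t ht)
  rw [ContinuousMap.norm_le _ (by positivity)]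
  intro x
  exact (convex_Ioi (0 : ℝ)).norm_image_sub_le_of_norm_hasDerivWithin_le
    (fun r hr => (hF r hr x).hasDerivWithinAt)
    (fun r hr => ((F' r).norm_coe_le_norm x).trans (hC r hr)) ht hs

/-! ### Differentiating Gibbs averages -/

section Deriv

variable {X : Type*} [TopologicalSpace X] [CompactSpace X] [MeasurableSpace X] [BorelSpace X]

lemma hasDerivAt_integral_mul_exp (P : ProbabilityMeasure X) {V g F F' : ℝ → C(X, ℝ)} {C D : ℝ}
    (hV : ∀ t, 0 < t → ∀ x, HasDerivAt (fun s => V s x) (g t x) t)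
    (hg : ∀ t, 0 < t → ‖g t‖ ≤ C)
    (hF : ∀ t, 0 < t → ∀ x, HasDerivAt (fun s => F s x) (F' t x) t)
    (hF' : ∀ t, 0 < t → ‖F' t‖ ≤ D) {t : ℝ} (ht : 0 < t) :
    HasDerivAt (fun s => ∫ x, F s x * Real.exp (-V s x) ∂(P : Measure X))
      (∫ x, (F' t x - F t x * g t x) * Real.exp (-V t x) ∂(P : Measure X)) t := by
  have hC0 : 0 ≤ C := (norm_nonneg _).trans (hg t ht)
  have hD0 : 0 ≤ D := (norm_nonneg _).trans (hF' t ht)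
  have hbd {G G' : ℝ → C(X, ℝ)} {B : ℝ}
      (hG : ∀ t, 0 < t → ∀ x, HasDerivAt (fun s => G s x) (G' t x) t)
      (hB : ∀ t, 0 < t → ‖G' t‖ ≤ B) {s : ℝ} (hs : s ∈ Ioo 0 (2 * t)) :
      ‖G s‖ ≤ ‖G t‖ + B * t := by
    have hB0 : 0 ≤ B := (norm_nonneg _).trans (hB t ht)
    have h1 := norm_sub_le_of_hasDerivAt hG hB hs.1 ht
    have h2 : |s - t| ≤ t := by rw [abs_le]; constructor <;> linarith [hs.1, hs.2]
    have h3 : B * |s - t| ≤ B * t := mul_le_mul_of_nonneg_left h2 hB0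
    have h4 : ‖G s‖ ≤ ‖G t‖ + ‖G s - G t‖ := by
      simpa using norm_add_le (G t) (G s - G t)
    linarith
  -- On `(0, 2t)` times are positive and within `t` of `t`, so the Lipschitz bounds give a constant
  -- dominating function.
  refine (hasDerivAt_integral_of_dominated_loc_of_deriv_le (s := Ioo 0 (2 * t))
    (F' := fun s x => (F' s x - F s x * g s x) * Real.exp (-V s x))
    (bound := fun _ => (D + (‖F t‖ + D * t) * C) * Real.exp (‖V t‖ + C * t))
    (Ioo_mem_nhds ht (by linarith)) ?_ ?_ ?_ ?_ (integrable_const _) ?_).2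
  · refine Eventually.of_forall fun s => Continuous.aestronglyMeasurable_of_compactSpace ?_
    fun_prop
  · exact integrable_continuousMap _ ⟨fun x => F t x * Real.exp (-V t x), by fun_prop⟩
  · refine Continuous.aestronglyMeasurable_of_compactSpace ?_
    fun_prop
  · refine Eventually.of_forall fun x s hs => ?_
    rw [norm_mul, Real.norm_eq_abs (Real.exp _), Real.abs_exp]
    have h1 : ‖F' s x‖ ≤ D := ((F' s).norm_coe_le_norm x).trans (hF' s hs.1)
    have h2 : ‖g s x‖ ≤ C := ((g s).norm_coe_le_norm x).trans (hg s hs.1)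
    have h3 : ‖F s x‖ ≤ ‖F t‖ + D * t := ((F s).norm_coe_le_norm x).trans (hbd hF hF' hs)
    have h4 : -V s x ≤ ‖V t‖ + C * t :=
      (neg_le_abs _).trans (((V s).norm_coe_le_norm x).trans (hbd hV hg hs))
    gcongr
    refine (norm_sub_le _ _).trans ?_
    rw [norm_mul]
    gcongr
  · refine Eventually.of_forall fun x s hs => ?_
    refine ((hF s hs.1 x).mul (hV s hs.1 x).fun_neg.exp).congr_deriv ?_
    ring

lemma integral_potentialDistribution (P : ProbabilityMeasure X) (V f : C(X, ℝ)) :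
    ∫ x, f x ∂(potentialDistribution P V : Measure X) =
      (∫ x, f x * Real.exp (-V x) ∂(P : Measure X)) / ∫ x, Real.exp (-V x) ∂(P : Measure X) := by
  change ∫ x, f x ∂((P : Measure X).tilted fun x => -V x) = _
  rw [integral_tilted, ← integral_div]
  refine integral_congr_ae (Eventually.of_forall fun x => ?_)
  simp only [smul_eq_mul]
  ring

lemma integral_exp_neg_pos (P : ProbabilityMeasure X) (V : C(X, ℝ)) :
    0 < ∫ x, Real.exp (-V x) ∂(P : Measure X) :=
  integral_exp_pos (integrable_continuousMap _ ⟨fun x => Real.exp (-V x), by fun_prop⟩)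

/-- The quotient rule, with `Z` differentiated too, gives `𝔼[F'] - Cov(F, g)`. -/
lemma hasDerivAt_integral_potentialDistribution (P : ProbabilityMeasure X)
    {V g F F' : ℝ → C(X, ℝ)} {C D : ℝ}
    (hV : ∀ t, 0 < t → ∀ x, HasDerivAt (fun s => V s x) (g t x) t)
    (hg : ∀ t, 0 < t → ‖g t‖ ≤ C)
    (hF : ∀ t, 0 < t → ∀ x, HasDerivAt (fun s => F s x) (F' t x) t)
    (hF' : ∀ t, 0 < t → ‖F' t‖ ≤ D) {t : ℝ} (ht : 0 < t) :
    HasDerivAt (fun s => ∫ x, F s x ∂(potentialDistribution P (V s) : Measure X))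
      ((∫ x, F' t x ∂(potentialDistribution P (V t) : Measure X)) -
        (∫ x, F t x * g t x ∂(potentialDistribution P (V t) : Measure X)) +
        (∫ x, F t x ∂(potentialDistribution P (V t) : Measure X)) *
          ∫ x, g t x ∂(potentialDistribution P (V t) : Measure X)) t := by
  have hA := hasDerivAt_integral_mul_exp P hV hg hF hF' ht
  have hZ := hasDerivAt_integral_mul_exp P (F := fun _ => 1) (F' := fun _ => 0) (D := 0) hV hg
    (fun t _ x => by simpa using hasDerivAt_const t (1 : ℝ)) (fun t _ => by simp) ht
  have hZpos := integral_exp_neg_pos P (V t)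
  simp only [ContinuousMap.one_apply, one_mul, ContinuousMap.zero_apply, zero_sub] at hZ
  simp only [integral_potentialDistribution]
  have hFg := integral_potentialDistribution P (V t) (F t * g t)
  have hF'g := integral_potentialDistribution P (V t) (F' t - F t * g t)
  have hneg := integral_potentialDistribution P (V t) (-g t)
  have hsub := integral_sub
    (integrable_continuousMap (potentialDistribution P (V t) : Measure X) (F' t))
    (integrable_continuousMap (potentialDistribution P (V t) : Measure X) (F t * g t))
  simp only [ContinuousMap.sub_apply, ContinuousMap.mul_apply, ContinuousMap.neg_apply,
    integral_neg] at hFg hF'g hneg hsub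
  rw [hF'g, integral_potentialDistribution] at hsub
  rw [integral_potentialDistribution] at hneg
  refine (hA.div hZ hZpos.ne').congr_deriv ?_
  rw [hFg] at hsub ⊢
  rw [← hsub]
  set Z := ∫ x, Real.exp (-V t x) ∂(P : Measure X)
  set A := ∫ x, F t x * Real.exp (-V t x) ∂(P : Measure X)
  set A' := ∫ x, (F' t x - F t x * g t x) * Real.exp (-V t x) ∂(P : Measure X)
  set B := ∫ x, -g t x * Real.exp (-V t x) ∂(P : Measure X)
  have h1 : (∫ x, g t x * Real.exp (-V t x) ∂(P : Measure X)) / Z = -(B / Z) := by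
    rw [← hneg, neg_neg]
  rw [h1]
  field_simp
  ring

end Deriv

/-! ### Weak limit points as cluster points -/

section WeakLimit

variable {X : Type*} [TopologicalSpace X] [MeasurableSpace X] [OpensMeasurableSpace X]

lemma isWeakLimitPoint_iff_mapClusterPt {Q : ℝ → ProbabilityMeasure X} {R : ProbabilityMeasure X} :
    IsWeakLimitPoint Q R ↔ MapClusterPt R atTop Q := by
  rw [MapClusterPt, clusterPt_iff_forall_mem_closure]
  refine ⟨fun h s hs => ?_, fun h T => h _ (image_mem_map (Ici_mem_atTop T))⟩
  obtain ⟨T, hT⟩ := mem_atTop_sets.1 (mem_map.1 hs)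
  exact closure_mono (image_subset_iff.2 hT) (h T)

lemma eq_of_isWeakLimitPoint {Q : ℝ → ProbabilityMeasure X} {R : ProbabilityMeasure X}
    (hR : IsWeakLimitPoint Q R) {φ : ProbabilityMeasure X → ℝ} (hφ : Continuous φ) {a : ℝ}
    (h : Tendsto (fun t => φ (Q t)) atTop (𝓝 a)) : φ R = a := by
  have h1 : MapClusterPt (φ R) atTop (φ ∘ Q) :=
    (isWeakLimitPoint_iff_mapClusterPt.1 hR).continuousAt_comp hφ.continuousAt
  have h2 : ClusterPt (φ R) (𝓝 a) := h1.clusterPt.mono h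
  by_contra hne
  exact h2.neBot.ne (disjoint_iff.1 (disjoint_nhds_nhds.2 hne))

end WeakLimit

/-! ### Energy dissipation along the flow -/

variable {X : Type*} [MetricSpace X] [CompactSpace X] [MeasurableSpace X] [BorelSpace X]
  {P Q' : ProbabilityMeasure X} {k : C(X, C(X, ℝ))} {V : ℝ → C(X, ℝ)}

lemma hasDerivAt_potential (hV : IsPotentialFlow P Q' (fun x y => k x y) V) {t : ℝ} (ht : 0 < t)
    (x : X) : HasDerivAt (fun s => V s x) (witness k Q' (potentialDistribution P (V t)) x) t :=
  (hV t ht.le x).hasDerivAt (Ici_mem_nhds ht)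

lemma hasDerivAt_witness (hV : IsPotentialFlow P Q' (fun x y => k x y) V) {t : ℝ} (ht : 0 < t)
    (x : X) : HasDerivAt (fun s => witness k Q' (potentialDistribution P (V s)) x)
      (witnessDeriv k Q' (potentialDistribution P (V t)) x) t := by
  simp only [witness_apply]
  refine ((hasDerivAt_integral_potentialDistribution P (F := fun _ => k x) (F' := fun _ => 0)
    (D := 0) (fun t ht x => hasDerivAt_potential hV ht x)
    (fun t _ => (witness k Q').norm_coe_le_norm (potentialDistribution P (V t)))
    (fun t _ y => hasDerivAt_const t (k x y)) (fun t _ => by simp) ht).sub_const _).congr_deriv ?_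
  rw [witnessDeriv_apply]
  simp
  ring

lemma hasDerivAt_discrepancy (hk : ∀ x y, k x y = k y x)
    (hV : IsPotentialFlow P Q' (fun x y => k x y) V) {t : ℝ} (ht : 0 < t) :
    HasDerivAt (fun s => discrepancy k Q' (potentialDistribution P (V s)))
      (-2 * dissipation k Q' (potentialDistribution P (V t))) t := by
  have h1 := hasDerivAt_integral_potentialDistribution P
    (F := fun s => witness k Q' (potentialDistribution P (V s)))
    (F' := fun s => witnessDeriv k Q' (potentialDistribution P (V s)))
    (fun t ht x => hasDerivAt_potential hV ht x)
    (fun t _ => (witness k Q').norm_coe_le_norm (potentialDistribution P (V t)))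
    (fun t ht x => hasDerivAt_witness hV ht x)
    (fun t _ => (witnessDeriv k Q').norm_coe_le_norm (potentialDistribution P (V t))) ht
  -- Zero potential makes the weight 1: differentiation under the fixed measure `Q'`.
  have h2 := hasDerivAt_integral_mul_exp Q' (V := fun _ => 0) (g := fun _ => 0) (C := 0)
    (F := fun s => witness k Q' (potentialDistribution P (V s)))
    (F' := fun s => witnessDeriv k Q' (potentialDistribution P (V s)))
    (fun t _ x => hasDerivAt_const t 0) (fun t _ => by simp)
    (fun t ht x => hasDerivAt_witness hV ht x)
    (fun t _ => (witnessDeriv k Q').norm_coe_le_norm (potentialDistribution P (V t))) ht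
  simp only [ContinuousMap.zero_apply, neg_zero, Real.exp_zero, mul_one, mul_zero, sub_zero] at h2
  refine (h1.sub h2).congr_deriv ?_
  -- One variance comes from the moving witness, the other from the moving measure.
  have h3 := integral_witnessDeriv_sub hk Q' (potentialDistribution P (V t))
  simp only [dissipation] at h3 ⊢
  linear_combination h3

/-- The derivative of the dissipation along the flow. -/
noncomputable def dissipationDeriv (k : C(X, C(X, ℝ))) (Q' Q : ProbabilityMeasure X) : ℝ :=
  (∫ x, (2 * witness k Q' Q * witnessDeriv k Q' Q) x ∂(Q : Measure X)) -
    (∫ x, (witness k Q' Q * witness k Q' Q * witness k Q' Q) x ∂(Q : Measure X)) +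
    (∫ x, (witness k Q' Q * witness k Q' Q) x ∂(Q : Measure X)) *
      (∫ x, witness k Q' Q x ∂(Q : Measure X)) -
    2 * (∫ x, witness k Q' Q x ∂(Q : Measure X)) *
      ((∫ x, witnessDeriv k Q' Q x ∂(Q : Measure X)) - dissipation k Q' Q)

/-- Compactness turns this into a bound uniform in time. -/
lemma continuous_dissipationDeriv (k : C(X, C(X, ℝ))) (Q' : ProbabilityMeasure X) :
    Continuous (dissipationDeriv k Q') := by
  have h (f : ProbabilityMeasure X → C(X, ℝ)) (hf : Continuous f) :
      Continuous fun Q : ProbabilityMeasure X => ∫ x, f Q x ∂(Q : Measure X) :=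
    Continuous.integral_probabilityMeasure continuous_id hf
  have hd := continuous_dissipation k Q'
  exact (((h _ (by fun_prop)).sub (h _ (by fun_prop))).add
    ((h _ (by fun_prop)).mul (h _ (by fun_prop)))).sub
    ((continuous_const.mul (h _ (by fun_prop))).mul ((h _ (by fun_prop)).sub hd))

lemma hasDerivAt_dissipation (hV : IsPotentialFlow P Q' (fun x y => k x y) V) {t : ℝ}
    (ht : 0 < t) : HasDerivAt (fun s => dissipation k Q' (potentialDistribution P (V s)))
      (dissipationDeriv k Q' (potentialDistribution P (V t))) t := by
  have hG (t : ℝ) : ‖witness k Q' (potentialDistribution P (V t))‖ ≤ ‖witness k Q'‖ :=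
    (witness k Q').norm_coe_le_norm _
  have hG' (t : ℝ) : ‖witnessDeriv k Q' (potentialDistribution P (V t))‖ ≤ ‖witnessDeriv k Q'‖ :=
    (witnessDeriv k Q').norm_coe_le_norm _
  have h1 := hasDerivAt_integral_potentialDistribution P
    (F := fun s => witness k Q' (potentialDistribution P (V s)))
    (F' := fun s => witnessDeriv k Q' (potentialDistribution P (V s)))
    (fun t ht x => hasDerivAt_potential hV ht x) (fun t _ => hG t)
    (fun t ht x => hasDerivAt_witness hV ht x) (fun t _ => hG' t) ht
  have h2 := hasDerivAt_integral_potentialDistribution P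
    (F := fun s => witness k Q' (potentialDistribution P (V s)) *
      witness k Q' (potentialDistribution P (V s)))
    (F' := fun s => 2 * witness k Q' (potentialDistribution P (V s)) *
      witnessDeriv k Q' (potentialDistribution P (V s))) (D := ‖(2 : C(X, ℝ))‖ * ‖witness k Q'‖ *
      ‖witnessDeriv k Q'‖)
    (fun t ht x => hasDerivAt_potential hV ht x) (fun t _ => hG t)
    (fun t ht x => ((hasDerivAt_witness hV ht x).mul (hasDerivAt_witness hV ht x)).congr_deriv (by
      have h : (2 : C(X, ℝ)) x = 2 := rfl
      simp only [ContinuousMap.mul_apply, h]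
      ring))
    (fun t _ => by
      refine (norm_mul_le _ _).trans (mul_le_mul ((norm_mul_le _ _).trans ?_) (hG' t)
        (norm_nonneg _) (by positivity))
      exact mul_le_mul_of_nonneg_left (hG t) (norm_nonneg _)) ht
  refine (h2.sub (h1.pow 2)).congr_deriv ?_
  simp only [dissipationDeriv, dissipation, ContinuousMap.mul_apply]
  ring

lemma tendsto_discrepancy_dissipation (hk : IntegrallyStrictlyPosDef fun x y => k x y)
    (hV : IsPotentialFlow P Q' (fun x y => k x y) V) :
    (∃ L, Tendsto (fun t => discrepancy k Q' (potentialDistribution P (V t))) atTop (𝓝 L)) ∧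
      Tendsto (fun t => dissipation k Q' (potentialDistribution P (V t))) atTop (𝓝 0) := by
  let W : C(ProbabilityMeasure X, ℝ) := ⟨_, continuous_dissipationDeriv k Q'⟩
  refine tendsto_zero_of_dissipation (b := 0) (C := ‖W‖ + 1) (by positivity)
    (fun t ht => hasDerivAt_discrepancy hk.1 hV ht) (fun t ht => hasDerivAt_dissipation hV ht)
    (fun t _ => (W.norm_coe_le_norm _).trans (le_add_of_nonneg_right zero_le_one))
    (fun t => dissipation_nonneg _ _ _) (fun t => ?_)
  by_cases h : potentialDistribution P (V t) = Q'
  · simp [discrepancy, h]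
  · exact (discrepancy_pos hk h).le

lemma dissipation_eq_zero_of_isWeakLimitPoint (hk : IntegrallyStrictlyPosDef fun x y => k x y)
    (hV : IsPotentialFlow P Q' (fun x y => k x y) V) {R : ProbabilityMeasure X}
    (hR : IsWeakLimitPoint (fun t => potentialDistribution P (V t)) R) :
    dissipation k Q' R = 0 :=
  eq_of_isWeakLimitPoint hR (continuous_dissipation k Q') (tendsto_discrepancy_dissipation hk hV).2

lemma eq_target_of_isWeakLimitPoint (hk : IntegrallyStrictlyPosDef fun x y => k x y)
    (hV : IsPotentialFlow P Q' (fun x y => k x y) V)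
    (hQ' : IsWeakLimitPoint (fun t => potentialDistribution P (V t)) Q') {R : ProbabilityMeasure X}
    (hR : IsWeakLimitPoint (fun t => potentialDistribution P (V t)) R) : R = Q' := by
  obtain ⟨L, hL⟩ := (tendsto_discrepancy_dissipation hk hV).1
  by_contra hne
  refine (discrepancy_pos hk hne).ne' ?_
  rw [eq_of_isWeakLimitPoint hR (continuous_discrepancy k Q') hL,
    ← eq_of_isWeakLimitPoint hQ' (continuous_discrepancy k Q') hL]
  simp [discrepancy]

/-! ### Convergent flows -/

lemma potential_le_of_witness_le (hV : IsPotentialFlow P Q' (fun x y => k x y) V) {T a : ℝ}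
    (hT : 0 < T) {x : X}
    (h : ∀ s, T ≤ s → witness k Q' (potentialDistribution P (V s)) x ≤ a) {t : ℝ} (ht : T ≤ t) :
    V t x ≤ V T x + a * (t - T) := by
  have hd : ∀ s ∈ Ici T, HasDerivAt (fun s => V s x) _ s := fun s hs =>
    hasDerivAt_potential hV (hT.trans_le hs) x
  have := (convex_Ici T).image_sub_le_mul_sub_of_deriv_le
    (fun s hs => (hd s hs).continuousAt.continuousWithinAt)
    (fun s hs => (hd s (interior_subset hs)).differentiableAt.differentiableWithinAt)
    (C := a) (fun s hs => by
      rw [(hd s (interior_subset hs)).deriv]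
      exact h s (interior_subset hs)) T self_mem_Ici t ht ht
  linarith

lemma le_potential_of_le_witness (hV : IsPotentialFlow P Q' (fun x y => k x y) V) {T a : ℝ}
    (hT : 0 < T) {x : X}
    (h : ∀ s, T ≤ s → a ≤ witness k Q' (potentialDistribution P (V s)) x) {t : ℝ} (ht : T ≤ t) :
    V T x + a * (t - T) ≤ V t x := by
  have hd : ∀ s ∈ Ici T, HasDerivAt (fun s => V s x) _ s := fun s hs =>
    hasDerivAt_potential hV (hT.trans_le hs) x
  have := (convex_Ici T).mul_sub_le_image_sub_of_le_deriv
    (fun s hs => (hd s hs).continuousAt.continuousWithinAt)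
    (fun s hs => (hd s (interior_subset hs)).differentiableAt.differentiableWithinAt)
    (C := a) (fun s hs => by
      rw [(hd s (interior_subset hs)).deriv]
      exact h s (interior_subset hs)) T self_mem_Ici t ht ht
  linarith

lemma le_witness_of_tendsto (hV : IsPotentialFlow P Q' (fun x y => k x y) V)
    {R : ProbabilityMeasure X} (hR : Tendsto (fun t => potentialDistribution P (V t)) atTop (𝓝 R))
    {c : ℝ} (hc : ∀ᵐ x ∂(R : Measure X), witness k Q' R x = c) {x : X}
    (hx : x ∈ (P : Measure X).support) : c ≤ witness k Q' R x := by
  by_contra! hlt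
  set g := witness k Q' R
  -- The `3 * δ` gap survives the error `δ / 2`: velocities stay below `c - 2 * δ` on `U` and above
  -- `c - δ` where `φ` is nonzero.
  obtain ⟨δ, hδ, hδx⟩ : ∃ δ > 0, g x < c - 3 * δ := ⟨(c - g x) / 4, by linarith, by linarith⟩
  have hclose : ∀ᶠ t in atTop, ‖witness k Q' (potentialDistribution P (V t)) - g‖ < δ / 2 := by
    have h1 := ((witness k Q').continuous.tendsto R).comp hR
    exact (tendsto_iff_norm_sub_tendsto_zero.1 h1).eventually_lt_const (half_pos hδ)
  obtain ⟨T₀, hT₀⟩ := eventually_atTop.1 hclose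
  set T := max T₀ 1
  have hT : 0 < T := lt_max_of_lt_right one_pos
  have hclose' : ∀ s, T ≤ s → ∀ y, |witness k Q' (potentialDistribution P (V s)) y - g y| < δ / 2 :=
    fun s hs y => ((witness k Q' (potentialDistribution P (V s)) - g).norm_coe_le_norm y).trans_lt
      (hT₀ s ((le_max_left _ _).trans hs))
  set U := {y | g y < c - 3 * δ}
  have hUo : IsOpen U := isOpen_lt g.continuous continuous_const
  have hU : 0 < (P : Measure X).real U :=
    ENNReal.toReal_pos (((Measure.mem_support_iff_forall x).1 hx) U (hUo.mem_nhds hδx)).ne'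
      (measure_ne_top _ _)
  -- A continuous test function, as weak convergence requires, vanishing where `g ≤ c - δ / 2` but
  -- with positive `R`-integral.
  let φ : C(X, ℝ) := ⟨fun y => max 0 (g y - (c - δ / 2)), by fun_prop⟩
  have hφR : ∫ y, φ y ∂(R : Measure X) = δ / 2 := by
    have : ∀ᵐ y ∂(R : Measure X), φ y = δ / 2 := by
      filter_upwards [hc] with y hy
      change max 0 (g y - (c - δ / 2)) = δ / 2
      rw [hy, sub_sub_cancel, max_eq_right (half_pos hδ).le]
    rw [integral_congr_ae this]
    simp
  have hlim : Tendsto (fun t => ∫ y, φ y ∂(potentialDistribution P (V t) : Measure X)) atTop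
      (𝓝 (δ / 2)) := by
    rw [← hφR]
    exact ProbabilityMeasure.tendsto_iff_forall_integral_tendsto.1 hR
      (BoundedContinuousFunction.mkOfCompact φ)
  have hnum : ∀ t, T ≤ t → ∫ y, φ y * Real.exp (-V t y) ∂(P : Measure X) ≤
      ‖φ‖ * Real.exp (‖V T‖ - (c - δ) * (t - T)) := by
    intro t ht
    have : ∫ y, φ y * Real.exp (-V t y) ∂(P : Measure X) ≤
        ∫ _, ‖φ‖ * Real.exp (‖V T‖ - (c - δ) * (t - T)) ∂(P : Measure X) := by
      refine integral_mono (integrable_continuousMap _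
        ⟨fun y => φ y * Real.exp (-V t y), by fun_prop⟩) (integrable_const _) fun y => ?_
      by_cases hy : g y ≤ c - δ / 2
      · have : φ y = 0 := max_eq_left (by linarith)
        simp only [this, zero_mul]
        positivity
      · have h1 := le_potential_of_le_witness hV (a := c - δ) hT (x := y) (fun s hs => by
          have := (abs_lt.1 (hclose' s hs y)).1
          push Not at hy
          linarith) ht
        have h2 : -V T y ≤ ‖V T‖ := (neg_le_abs _).trans ((V T).norm_coe_le_norm y)
        have h3 : φ y ≤ ‖φ‖ := (le_abs_self _).trans (φ.norm_coe_le_norm y)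
        refine mul_le_mul h3 (Real.exp_le_exp.2 (by linarith)) (Real.exp_pos _).le (norm_nonneg _)
    simpa using this
  have hden : ∀ t, T ≤ t → (P : Measure X).real U * Real.exp (-‖V T‖ - (c - 2 * δ) * (t - T)) ≤
      ∫ y, Real.exp (-V t y) ∂(P : Measure X) := by
    intro t ht
    have hint := integrable_continuousMap (P : Measure X) ⟨fun y => Real.exp (-V t y), by fun_prop⟩
    have h0 : ∫ y, U.indicator (fun _ => Real.exp (-‖V T‖ - (c - 2 * δ) * (t - T))) y
        ∂(P : Measure X) ≤ ∫ y, Real.exp (-V t y) ∂(P : Measure X) := by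
      refine integral_mono ((integrable_const _).indicator hUo.measurableSet) hint fun y => ?_
      by_cases hy : y ∈ U
      swap
      · simpa [hy] using (Real.exp_pos (-V t y)).le
      have h1 := potential_le_of_witness_le hV (a := c - 2 * δ) hT (x := y) (fun s hs => by
        have h2 := (abs_lt.1 (hclose' s hs y)).2
        have h3 : g y < c - 3 * δ := hy
        linarith) ht
      have h2 : V T y ≤ ‖V T‖ := (le_abs_self _).trans ((V T).norm_coe_le_norm y)
      rw [indicator_of_mem hy]
      exact Real.exp_le_exp.2 (by linarith)
    rwa [integral_indicator_const _ hUo.measurableSet, smul_eq_mul] at h0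
  have hbound : ∀ t, T ≤ t → ∫ y, φ y ∂(potentialDistribution P (V t) : Measure X) ≤
      ‖φ‖ * Real.exp (2 * ‖V T‖) / (P : Measure X).real U * Real.exp (-(δ * (t - T))) := by
    intro t ht
    rw [integral_potentialDistribution]
    refine (div_le_div₀ (by positivity) (hnum t ht) (by positivity) (hden t ht)).trans_eq ?_
    rw [mul_div_mul_comm, ← Real.exp_sub, mul_div_right_comm, mul_assoc, ← Real.exp_add]
    congr 2
    ring
  have hzero : Tendsto (fun t => ‖φ‖ * Real.exp (2 * ‖V T‖) / (P : Measure X).real U *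
      Real.exp (-(δ * (t - T)))) atTop (𝓝 0) := by
    have h1 : Tendsto (fun t => δ * (t - T)) atTop atTop :=
      (tendsto_atTop_add_const_right _ (-T) tendsto_id).const_mul_atTop hδ
    simpa using (Real.tendsto_exp_neg_atTop_nhds_zero.comp h1).const_mul
      (‖φ‖ * Real.exp (2 * ‖V T‖) / (P : Measure X).real U)
  have := le_of_tendsto_of_tendsto hlim hzero (by
    filter_upwards [eventually_ge_atTop T] with t ht using hbound t ht)
  linarith

lemma eq_target_of_tendsto (hk : IntegrallyStrictlyPosDef fun x y => k x y)
    (hQ' : (Q' : Measure X).support ⊆ (P : Measure X).support)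
    (hV : IsPotentialFlow P Q' (fun x y => k x y) V)
    {R : ProbabilityMeasure X} (hR : Tendsto (fun t => potentialDistribution P (V t)) atTop (𝓝 R)) :
    R = Q' := by
  by_contra hne
  have h0 : dissipation k Q' R = 0 := dissipation_eq_zero_of_isWeakLimitPoint hk hV
    (isWeakLimitPoint_iff_mapClusterPt.2 hR.mapClusterPt)
  have hpos := discrepancy_pos hk hne
  set c := ∫ y, witness k Q' R y ∂(R : Measure X)
  have hc : ∀ᵐ x ∂(R : Measure X), witness k Q' R x = c := by
    filter_upwards [Measure.support_mem_ae (μ := (R : Measure X))] with x hx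
    exact witness_eq_of_mem_support h0 hx
  have h1 : ∫ _, c ∂(Q' : Measure X) ≤ ∫ x, witness k Q' R x ∂(Q' : Measure X) := by
    refine integral_mono_ae (integrable_const _) (integrable_continuousMap _ _) ?_
    filter_upwards [Measure.support_mem_ae (μ := (Q' : Measure X))] with x hx
    exact le_witness_of_tendsto hV hR hc (hQ' hx)
  rw [integral_const] at h1
  simp only [discrepancy] at hpos
  simp at h1
  linarith

end PotentialFlow

theorem mainTheorem9 {d : ℕ} (K : TopologicalSpace.Compacts (EuclideanSpace ℝ (Fin d)))
    (hK : 0 < volume (K : Set (EuclideanSpace ℝ (Fin d))))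
    (k : K → K → ℝ) (hk : Continuous (Function.uncurry k)) (hk_pos : IntegrallyStrictlyPosDef k)
    (Q' : ProbabilityMeasure K)
    (hQ' : (Q' : Measure K).support ⊆ (uniformOnCompact K hK : Measure K).support)
    (V₀ : C(K, ℝ)) (V : ℝ → C(K, ℝ)) (hV₀ : V 0 = V₀)
    (hV : IsPotentialFlow (uniformOnCompact K hK) Q' k V)
    (Q : ℝ → ProbabilityMeasure K)
    (hQ : ∀ t, Q t = potentialDistribution (uniformOnCompact K hK) (V t)) :
    ((∃! R : ProbabilityMeasure K, IsWeakLimitPoint Q R) → Tendsto Q atTop (𝓝 Q')) ∧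
    ((¬ ∃! R : ProbabilityMeasure K, IsWeakLimitPoint Q R) →
      ∀ R : ProbabilityMeasure K, IsWeakLimitPoint Q R →
        ¬ (Q' : Measure K).support ⊆ (R : Measure K).support) := by
  obtain rfl : Q = fun t => potentialDistribution (uniformOnCompact K hK) (V t) := funext hQ
  let κ : C(K, C(K, ℝ)) := ContinuousMap.curry ⟨Function.uncurry k, hk⟩
  have hκ : IntegrallyStrictlyPosDef fun x y => κ x y := hk_pos
  have hVκ : IsPotentialFlow (uniformOnCompact K hK) Q' (fun x y => κ x y) V := hV
  constructor
  · rintro ⟨R, -, hR⟩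
    have hlim : Tendsto (fun t => potentialDistribution (uniformOnCompact K hK) (V t)) atTop
        (𝓝 R) := by
      -- Compactness of the space of probability measures enters here.
      refine le_nhds_of_unique_clusterPt fun R' hR' => hR R' ?_
      exact PotentialFlow.isWeakLimitPoint_iff_mapClusterPt.2 hR'
    rwa [PotentialFlow.eq_target_of_tendsto hκ hQ' hVκ hlim] at hlim
  · intro hnot R hR hsub
    have hRQ : R = Q' := PotentialFlow.eq_of_support_subset hκ
      (PotentialFlow.dissipation_eq_zero_of_isWeakLimitPoint hκ hVκ hR) hsub
    subst hRQ
    exact hnot ⟨R, hR, fun R' hR' => PotentialFlow.eq_target_of_isWeakLimitPoint hκ hVκ hR hR'⟩
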